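/- Let $\mathcal X$ be a finite state space. Let $\Omega$ be a set of paths $\omega:[0,\infty)\to\mathcal X$ that is rich enough in the following sense: for all finitely many (at least one) distinct time points $t_0<\dots<t_n$ in $[0,\infty)$ and all states $x_0,\dots,x_n\in\mathcal X$ there is some $\omega\in\Omega$ with $\omega(t_i)=x_i$ for all $i$. For a finite (possibly empty) set of time points $u\subset[0,\infty)$, write $u<t$ if $r<t$ for all $r\in u$. For $t\ge 0$ and $x\in\mathcal X$ let $(X_t=x):=\{\omega\in\Omega:\omega(t)=x\}$, and for $x_u=(x_r)_{r\in u}\in\mathcal X^u$ let $(X_u=x_u):=\{\omega\in\Omega:\omega(r)=x_r\text{ for all }r\in u\}$, so that $(X_\emptyset=x_\emptyset)=\Omega$. Let $\mathcal A_u$ be the algebra of subsets of $\Omega$ generated by the events $(X_t=x)$ with $x\in\mathcal X$ and with $t\in u$ or $t>u$. Let $$\mathcal C^{SP}:=\{(A,(X_u=x_u)) : u\subset[0,\infty)\text{ finite},\ x_u\in\mathcal X^u,\ A\in\mathcal A_u\}.$$ A real-valued map $P$ on a set $\mathcal C$ of pairs $(A,C)$ of events with $C\neq\emptyset$ is a *coherent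 conditional probability* on $\mathcal C$ if, for all $n\geq 1$, all $(A_i,C_i)\in\mathcal C$ and all $\lambda_i\in\mathbb R$, $i=1,\dots,n$, $$\max\Big\{\sum_{i=1}^n\lambda_i\mathbb I_{C_i}(\omega)\big(P(A_i\mid C_i)-\mathbb I_{A_i}(\omega)\big) : \omega\in \bigcup_{i=1}^n C_i\Big\}\geq 0 .$$ A *stochastic process* is a coherent conditional probability $P$ on $\mathcal C^{SP}$; write $P(A):=P(A\mid\Omega)$. It is a *Markov chain* if $P(X_s=y\mid X_t=x,X_u=x_u)=P(X_s=y\mid X_t=x)$ for all $t\le s$, all finite $u<t$, all $x_u\in\mathcal X^u$ and all $x,y\in\mathcal X$. It is *well-behaved* if, for all finite (possibly empty) $u$, all $t\ge 0$ with $u<t$, all $x_u\in\mathcal X^u$ and all $x,y\in\mathcal X$, $$\limsup_{\Delta\to0^+}\tfrac1\Delta\big|P(X_{t+\Delta}=y\mid X_t=x,X_u=x_u)-\mathbb I_x(y)\big|<+\infty$$ and, if $t\neq 0$, $$\limsup_{\Delta\to0^+}\tfrac1\Delta\big|P(X_t=y\mid X_{t-\Delta}=x,X_u=x_u)-\mathbb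 I_x(y)\big|<+\infty .$$ Let $\mathcal T_P$ be the family of matrices $T_t^s(x,y):=P(X_s=y\mid X_t=x)$, $0\le t\le s$. A *transition matrix system* is a family $\mathcal T=(T_t^s)_{0\le t\le s}$ of row-stochastic real $\mathcal X\times\mathcal X$ matrices such that $T_t^s=T_t^rT_r^s$ for all $t\le r\le s$ and $T_t^t=I$ for all $t\geq 0$. It is *well-behaved* if $\limsup_{\Delta\to0^+}\frac1\Delta\|T_t^{t+\Delta}-I\|<+\infty$ for all $t\ge0$ and $\limsup_{\Delta\to0^+}\frac1\Delta\|T_{t-\Delta}^{t}-I\|<+\infty$ for all $t>0$, where $\|\cdot\|$ is the operator norm induced by the maximum norm on $\mathbb R^{\mathcal X}$. **Theorem.** Let $p$ be any probability mass function on $\mathcal X$ and let $\mathcal T$ be any transition matrix system. Then there is a unique Markov chain $P$ such that $\mathcal T_P=\mathcal T$ and $P(X_0=y)=p(y)$ for all $y\in\mathcal X$. Furthermore, $P$ is well-behaved if and only if $\mathcal T$ is well-behaved. -/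

import Mathlib

open scoped NNReal Topology

noncomputable section

namespace CTMC

/-! ### Transition matrix systems -/

/-- A family of square matrices `T_t^s`, one for all time points `t ≤ s` in `[0, ∞)`. -/
abbrev MatrixFamily (X : Type*) : Type _ :=
  ∀ t s : ℝ≥0, t ≤ s → Matrix X X ℝ

/-- The norm of a matrix `A`, as an operator on the functions `X → ℝ` with the maximum norm. -/
def matNorm {X : Type*} [Fintype X] (A : Matrix X X ℝ) : ℝ :=
  ‖(ContinuousLinearMap.mk (Matrix.mulVecLin A) : (X → ℝ) →L[ℝ] (X → ℝ))‖

/-- A transition matrix system: a family of transition (that is, row-stochastic) matrices with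
the semi-group property and with `T_t^t = I`. -/
structure IsTransitionMatrixSystem {X : Type*} [Fintype X] [DecidableEq X]
    (T : MatrixFamily X) : Prop where
  nonneg : ∀ (t s : ℝ≥0) (hts : t ≤ s) (x y : X), 0 ≤ T t s hts x y
  sum_one : ∀ (t s : ℝ≥0) (hts : t ≤ s) (x : X), ∑ y, T t s hts x y = 1
  semigroup : ∀ (t r s : ℝ≥0) (htr : t ≤ r) (hrs : r ≤ s),
    T t s (htr.trans hrs) = T t r htr * T r s hrs
  self_eq_one : ∀ t : ℝ≥0, T t t le_rfl = 1

/-- A family of matrices is well-behaved if, for all `t ≥ 0`,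
`limsup_{Δ → 0⁺} (1/Δ) ‖T_t^{t+Δ} - I‖ < +∞` and, for all `t > 0`,
`limsup_{Δ → 0⁺} (1/Δ) ‖T_{t-Δ}^t - I‖ < +∞`. The limits superior are extended reals. -/
def IsWellBehavedFamily {X : Type*} [Fintype X] [DecidableEq X] (T : MatrixFamily X) : Prop :=
  (∀ t : ℝ≥0,
    Filter.limsup
      (fun Δ : ℝ≥0 =>
        (((1 / (Δ : ℝ)) * matNorm (T t (t + Δ) le_self_add - 1) : ℝ) : EReal))
      (𝓝[>] (0 : ℝ≥0)) < ⊤) ∧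
  (∀ t : ℝ≥0, 0 < t →
    Filter.limsup
      (fun Δ : ℝ≥0 =>
        (((1 / (Δ : ℝ)) * matNorm (T (t - Δ) t tsub_le_self - 1) : ℝ) : EReal))
      (𝓝[>] (0 : ℝ≥0)) < ⊤)

/-! ### Coherent conditional probabilities -/

/-- A real-valued map `P` on a set `𝒞` of pairs (event, conditioning event) is a coherent
conditional probability on `𝒞` if every conditioning event is non-empty and, for all `n ≥ 1`,
all `(A_i, C_i) ∈ 𝒞` and all real `λ_i`, the maximum of
`∑ i, λ_i * 1_{C_i}(ω) * (P(A_i | C_i) - 1_{A_i}(ω))` over `ω ∈ ⋃ i, C_i` is non-negative.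
The sum takes only finitely many values, so this says that it is non-negative for
some `ω ∈ ⋃ i, C_i`. -/
def IsCoherent {Ω : Type*} (𝒞 : Set (Set Ω × Set Ω)) (P : 𝒞 → ℝ) : Prop :=
  (∀ c ∈ 𝒞, c.2.Nonempty) ∧
  ∀ (n : ℕ), 0 < n → ∀ (c : Fin n → 𝒞) (l : Fin n → ℝ),
    ∃ ω ∈ ⋃ i, (c i).1.2,
      0 ≤ ∑ i, l i * (c i).1.2.indicator (fun _ => (1 : ℝ)) ω *
        (P (c i) - (c i).1.1.indicator (fun _ => (1 : ℝ)) ω)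

/-! ### Stochastic processes

The outcome space is a set `Ω` of paths `ℝ≥0 → X`, and events are subsets of it. Finite strictly
increasing sequences of time points are represented by finite sets `u : Finset ℝ≥0`, and a joint
state `x_u` by a function `u → X`. -/

variable {X : Type*}

/-- Every assignment of states to finitely many (at least one) time points is realised by some
path in `Ω`. -/
def IsRichPathSpace (Ω : Set (ℝ≥0 → X)) : Prop :=
  ∀ u : Finset ℝ≥0, u.Nonempty → ∀ xu : u → X, ∃ ω ∈ Ω, ∀ t : u, ω t = xu t

/-- The elementary event `(X_t = x)`. -/
def stateEvent (Ω : Set (ℝ≥0 → X)) (t : ℝ≥0) (x : X) : Set Ω :=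
  {ω | ω.1 t = x}

/-- The event `(X_u = x_u)`; it is the whole of `Ω` if `u` is empty. -/
def jointEvent (Ω : Set (ℝ≥0 → X)) (u : Finset ℝ≥0) (xu : u → X) : Set Ω :=
  {ω | ∀ t : u, ω.1 t = xu t}

/-- The elementary events whose time point belongs to `u` or comes after all of `u`. -/
def elementaryEvents (Ω : Set (ℝ≥0 → X)) (u : Finset ℝ≥0) : Set (Set Ω) :=
  {E | ∃ (t : ℝ≥0) (x : X), (t ∈ u ∨ ∀ r ∈ u, r < t) ∧ E = stateEvent Ω t x}

/-- The algebra of events generated by `elementaryEvents Ω u`. -/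
def eventAlgebra (Ω : Set (ℝ≥0 → X)) (u : Finset ℝ≥0) : Set (Set Ω) :=
  MeasureTheory.generateSetAlgebra (elementaryEvents Ω u)

/-- The domain `𝒞^SP` of a stochastic process: all pairs `(A, X_u = x_u)` with `A` in the algebra
of events that belongs to `u`. -/
def domainSP (Ω : Set (ℝ≥0 → X)) : Set (Set Ω × Set Ω) :=
  {c | ∃ (u : Finset ℝ≥0) (xu : u → X), c.1 ∈ eventAlgebra Ω u ∧ c.2 = jointEvent Ω u xu}

/-- `(X_s = y, (X_t = x) ∩ (X_u = x_u))` belongs to the domain if `u < t ≤ s`. -/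
theorem mem_domainSP_history (Ω : Set (ℝ≥0 → X)) {t s : ℝ≥0} (hts : t ≤ s) {u : Finset ℝ≥0}
    (hu : ∀ r ∈ u, r < t) (xu : u → X) (x y : X) :
    (stateEvent Ω s y, stateEvent Ω t x ∩ jointEvent Ω u xu) ∈ domainSP Ω := by
  classical
  refine ⟨insert t u, fun r => if h : r.1 ∈ u then xu ⟨r.1, h⟩ else x, ?_, ?_⟩
  · refine .base _ ⟨s, y, ?_, rfl⟩
    rcases hts.eq_or_lt with rfl | h
    · exact .inl (Finset.mem_insert_self _ _)
    · refine .inr fun r hr => ?_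
      rcases Finset.mem_insert.1 hr with rfl | hr
      · exact h
      · exact (hu r hr).trans h
  · have ht : t ∉ u := fun h => lt_irrefl _ (hu t h)
    ext ω
    simp only [stateEvent, jointEvent, Set.mem_inter_iff, Set.mem_ofPred_eq, Subtype.forall,
      Finset.mem_insert]
    constructor
    · rintro ⟨h1, h2⟩ r hr
      by_cases h : r ∈ u
      · simp [h, h2 r h]
      · obtain rfl : r = t := hr.resolve_right h
        simp [h, h1]
    · intro H
      refine ⟨by simpa [ht] using H t (.inl rfl), fun r hr => by simpa [hr] using H r (.inr hr)⟩

/-- `(X_s = y, X_t = x)` belongs to the domain if `t ≤ s`. -/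
theorem mem_domainSP_state (Ω : Set (ℝ≥0 → X)) {t s : ℝ≥0} (hts : t ≤ s) (x y : X) :
    (stateEvent Ω s y, stateEvent Ω t x) ∈ domainSP Ω := by
  have h := mem_domainSP_history Ω hts (u := ∅) (by simp) (fun _ => x) x y
  simpa [jointEvent] using h

/-- `(X_s = y, Ω)` belongs to the domain. -/
theorem mem_domainSP_univ (Ω : Set (ℝ≥0 → X)) (s : ℝ≥0) (y : X) :
    (stateEvent Ω s y, Set.univ) ∈ domainSP Ω :=
  ⟨∅, fun _ => y, .base _ ⟨s, y, .inr (by simp), rfl⟩, by simp [jointEvent]⟩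

variable {Ω : Set (ℝ≥0 → X)}

/-- A stochastic process is a coherent conditional probability on `𝒞^SP`. -/
def IsStochasticProcess (P : domainSP Ω → ℝ) : Prop :=
  IsCoherent (domainSP Ω) P

/-- The unconditional probability `P(X_s = y) = P(X_s = y | Ω)`. -/
def stateProb (P : domainSP Ω → ℝ) (s : ℝ≥0) (y : X) : ℝ :=
  P ⟨(stateEvent Ω s y, Set.univ), mem_domainSP_univ Ω s y⟩

/-- The family `𝒯_P` of matrices `T_t^s(x, y) = P(X_s = y | X_t = x)`. -/
def transitionFamily (P : domainSP Ω → ℝ) : MatrixFamily X :=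
  fun _ _ hts => Matrix.of fun x y => P ⟨_, mem_domainSP_state Ω hts x y⟩

/-- The history-dependent transition probability `P(X_s = y | X_t = x, X_u = x_u)`, for
`u < t ≤ s`. -/
def historyProb (P : domainSP Ω → ℝ) {t s : ℝ≥0} (hts : t ≤ s) {u : Finset ℝ≥0}
    (hu : ∀ r ∈ u, r < t) (xu : u → X) (x y : X) : ℝ :=
  P ⟨_, mem_domainSP_history Ω hts hu xu x y⟩

/-- A stochastic process `P` is a Markov chain if
`P(X_s = y | X_t = x, X_u = x_u) = P(X_s = y | X_t = x)` whenever `u < t ≤ s`. -/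
def IsMarkovChain (P : domainSP Ω → ℝ) : Prop :=
  IsStochasticProcess P ∧
  ∀ (t s : ℝ≥0) (hts : t ≤ s) (u : Finset ℝ≥0) (hu : ∀ r ∈ u, r < t) (xu : u → X) (x y : X),
    historyProb P hts hu xu x y = transitionFamily P t s hts x y

open Classical in
/-- A stochastic process `P` is well-behaved if for every finite (possibly empty) `u`, every
`x_u`, all `x, y` and all `t > u`,
`limsup_{Δ → 0⁺} (1/Δ) |P(X_{t+Δ} = y | X_t = x, X_u = x_u) - 1_x(y)| < +∞` and, if `t ≠ 0`,
`limsup_{Δ → 0⁺} (1/Δ) |P(X_t = y | X_{t-Δ} = x, X_u = x_u) - 1_x(y)| < +∞`.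
In the second one the conditional probability is in the domain of `P` if `u < t - Δ`, which
is the case for all small `Δ > 0`; the value `0` used for other `Δ` is immaterial. -/
def IsWellBehavedProcess (P : domainSP Ω → ℝ) : Prop :=
  ∀ (u : Finset ℝ≥0) (xu : u → X) (x y : X) (t : ℝ≥0) (hu : ∀ r ∈ u, r < t),
    Filter.limsup
      (fun Δ : ℝ≥0 =>
        (((1 / (Δ : ℝ)) *
          |historyProb P (le_self_add : t ≤ t + Δ) hu xu x y
            - if y = x then 1 else 0| : ℝ) : EReal))
      (𝓝[>] (0 : ℝ≥0)) < ⊤ ∧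
    (t ≠ 0 →
      Filter.limsup
        (fun Δ : ℝ≥0 =>
          if hΔ : ∀ r ∈ u, r < t - Δ then
            (((1 / (Δ : ℝ)) *
              |historyProb P (tsub_le_self : t - Δ ≤ t) hΔ xu x y
                - if y = x then 1 else 0| : ℝ) : EReal)
          else 0)
        (𝓝[>] (0 : ℝ≥0)) < ⊤)

end CTMC

end

namespace CTMC

open MeasureTheory Filter

/-! ### Consequences of coherence -/

section Coherence

variable {Ω : Type*} {𝒞 : Set (Set Ω × Set Ω)} {P : 𝒞 → ℝ}

/-! Uniqueness: coherence applied to stakes of both signs gives the law of total probability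
(`IsCoherent.total_prob`). Given `X_u = x_u`, an event of the algebra depends on `u` and finitely
many later times. Conditioning on these in increasing order uses only one-step probabilities, which
the Markov property reduces to `T`, or to `p` when `u` is empty and time `0` is the first step; in
the end the event is decided by the conditioning event (`IsMarkovChain.eq_of_transitionFamily_eq`).

Existence: on a finite grid the chain is a finite iterated sum, but conditioning events may have
probability zero. Mixing the kernel with the uniform distribution makes every joint event of the
grid positive, so Bayes' rule yields coherent values (`gridProb_coherent`) for which the history
drops out (`gridProb_history`). Coherence of a finite family is a closed condition and `[0,1]^𝒞` is
compact, so limits may be taken along ultrafilters: first `ε → 0`, where Chapman-Kolmogorov removes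
intermediate grid points, then over growing grids.

Well-behavedness: the Markov property turns the process quotients into matrix entries, and entrywise
bounds are equivalent to norm bounds in finite dimension. -/

/-- A finite combination of gambles that is constant on the union of the conditioning events
vanishes there. -/
theorem IsCoherent.eq_zero_of_const (hP : IsCoherent 𝒞 P) {ι : Type*} [Fintype ι] [Nonempty ι]
    (c : ι → 𝒞) (l : ι → ℝ) (k : ℝ)
    (h : ∀ ω ∈ ⋃ i, (c i).1.2, ∑ i, l i * (c i).1.2.indicator (fun _ => (1 : ℝ)) ω *
        (P (c i) - (c i).1.1.indicator (fun _ => (1 : ℝ)) ω) = k) : k = 0 := by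
  -- Scaling all stakes by `a` scales the constant gain; `a = 1` and `a = -1` then force it to
  -- vanish.
  have key : ∀ a : ℝ, 0 ≤ a * k := by
    intro a
    let e := (Fintype.equivFin ι).symm
    obtain ⟨ω, hω, hs⟩ := hP.2 (Fintype.card ι) Fintype.card_pos (fun i => c (e i))
      (fun i => a * l (e i))
    rw [e.surjective.iUnion_comp (fun i => (c i).1.2)] at hω
    rw [← h ω hω, Finset.mul_sum]
    rw [e.sum_comp (fun i => a * l i * (c i).1.2.indicator (fun _ => (1 : ℝ)) ω *
        (P (c i) - (c i).1.1.indicator (fun _ => (1 : ℝ)) ω))] at hs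
    simpa only [mul_assoc] using hs
  have h1 := key 1
  have h2 := key (-1)
  linarith

theorem IsCoherent.eq_of_indicator_eq (hP : IsCoherent 𝒞 P) (c : 𝒞) (k : ℝ)
    (h : ∀ ω ∈ c.1.2, c.1.1.indicator (fun _ => (1 : ℝ)) ω = k) : P c = k := by
  refine sub_eq_zero.1 (hP.eq_zero_of_const (fun _ : Unit => c) (fun _ => 1) _ fun ω hω => ?_)
  simp only [Set.iUnion_const] at hω
  simp [h ω hω, hω]

/-- The law of total probability. -/
theorem IsCoherent.total_prob (hP : IsCoherent 𝒞 P) {X : Type*} [Fintype X] {A C : Set Ω}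
    {B : X → Set Ω} (hB : ∀ ω, ∃ z, ∀ y, ω ∈ B y ↔ y = z) (hA : (A, C) ∈ 𝒞)
    (hBC : ∀ y, (B y, C) ∈ 𝒞) (hABC : ∀ y, (A, C ∩ B y) ∈ 𝒞) :
    P ⟨_, hA⟩ = ∑ y, P ⟨_, hBC y⟩ * P ⟨_, hABC y⟩ := by
  classical
  -- Stakes: `1` on `A | C`, `-1` on `A | C ∩ B y`, and `-P(A | C ∩ B y)` on `B y | C`. On `C` the
  -- indicators of `A` cancel and the gain is the constant difference of the two sides.
  refine sub_eq_zero.1 (hP.eq_zero_of_const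
    (fun i : Option (X ⊕ X) => i.elim ⟨_, hA⟩
      (Sum.elim (fun y => ⟨_, hABC y⟩) (fun y => ⟨_, hBC y⟩)))
    (fun i => i.elim 1 (Sum.elim (fun _ => -1) (fun y => -P ⟨_, hABC y⟩))) _ fun ω hω => ?_)
  have hC : ω ∈ C := by
    obtain ⟨i, hi⟩ := Set.mem_iUnion.1 hω
    rcases i with _ | y | y
    · exact hi
    · exact hi.1
    · exact hi
  obtain ⟨z, hz⟩ := hB ω
  simp only [Fintype.sum_option, Fintype.sum_sum_type, Option.elim, Sum.elim_inl, Sum.elim_inr]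
  simp only [Set.indicator_apply, Set.mem_inter_iff, hC, hz, true_and, if_true, one_mul, mul_one,
    mul_ite, mul_zero, ite_mul, zero_mul, Finset.sum_ite_eq', Finset.mem_univ, mul_sub,
    Finset.sum_sub_distrib]
  simp only [neg_mul, Finset.sum_neg_distrib, mul_comm (P ⟨_, hBC _⟩)]
  split_ifs <;> simp <;> ring

end Coherence

/-! ### Cylinder events -/

variable {X : Type*}

/-- The algebra of events that depend on the states at the time points in `F`. -/
def cylinderAlgebra (Ω : Set (ℝ≥0 → X)) (F : Set ℝ≥0) : Set (Set Ω) :=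
  generateSetAlgebra {E | ∃ t ∈ F, ∃ x, E = stateEvent Ω t x}

theorem cylinderAlgebra_mono (Ω : Set (ℝ≥0 → X)) {F G : Set ℝ≥0} (h : F ⊆ G) :
    cylinderAlgebra Ω F ⊆ cylinderAlgebra Ω G :=
  generateSetAlgebra_mono fun _ ⟨t, ht, x, e⟩ => ⟨t, h ht, x, e⟩

theorem cylinderAlgebra_subset_eventAlgebra (Ω : Set (ℝ≥0 → X)) {u : Finset ℝ≥0} {F : Set ℝ≥0}
    (h : ∀ t ∈ F, t ∈ u ∨ ∀ r ∈ u, r < t) : cylinderAlgebra Ω F ⊆ eventAlgebra Ω u :=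
  generateSetAlgebra_mono fun _ ⟨t, ht, x, e⟩ => ⟨t, x, h t ht, e⟩

/-- Each element of a generated algebra involves finitely many generators; this makes induction over
time points possible. -/
theorem exists_finset_mem_cylinderAlgebra {Ω : Set (ℝ≥0 → X)} {u : Finset ℝ≥0} {A : Set Ω}
    (hA : A ∈ eventAlgebra Ω u) :
    ∃ F : Finset ℝ≥0, (∀ t ∈ F, t ∈ u ∨ ∀ r ∈ u, r < t) ∧ A ∈ cylinderAlgebra Ω F := by
  classical
  induction hA with
  | base s hs =>
    obtain ⟨t, x, ht, rfl⟩ := hs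
    exact ⟨{t}, by simpa using ht, .base _ ⟨t, by simp, x, rfl⟩⟩
  | empty => exact ⟨∅, by simp, .empty⟩
  | compl s _ ih =>
    obtain ⟨F, hF, hs⟩ := ih
    exact ⟨F, hF, .compl _ hs⟩
  | union s t _ _ ihs iht =>
    obtain ⟨F, hF, hs⟩ := ihs
    obtain ⟨G, hG, ht⟩ := iht
    refine ⟨F ∪ G, fun r hr => (Finset.mem_union.1 hr).elim (hF r) (hG r), .union _ _ ?_ ?_⟩
    · exact cylinderAlgebra_mono Ω (by simp) hs
    · exact cylinderAlgebra_mono Ω (by simp) ht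

/-- Membership in a cylinder event depends only on the states at its time points. -/
theorem mem_iff_of_mem_cylinderAlgebra {Ω : Set (ℝ≥0 → X)} {F : Set ℝ≥0} {A : Set Ω}
    (hA : A ∈ cylinderAlgebra Ω F) {ω η : Ω} (h : ∀ t ∈ F, ω.1 t = η.1 t) : ω ∈ A ↔ η ∈ A := by
  induction hA with
  | base s hs =>
    obtain ⟨t, ht, x, rfl⟩ := hs
    simp only [stateEvent, Set.mem_ofPred_eq, h t ht]
  | empty => simp
  | compl s _ ih => simp [ih]
  | union s t _ _ ihs iht => simp [ihs, iht]

/-- A joint event can be refined by the state at one further time point. -/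
theorem exists_jointEvent_insert (Ω : Set (ℝ≥0 → X)) {u : Finset ℝ≥0} {s : ℝ≥0} (hs : s ∉ u)
    (xu : u → X) (y : X) :
    ∃ xv : ↥(insert s u) → X,
      jointEvent Ω (insert s u) xv = jointEvent Ω u xu ∩ stateEvent Ω s y := by
  classical
  refine ⟨fun r => if h : r.1 ∈ u then xu ⟨r.1, h⟩ else y, ?_⟩
  ext ω
  simp only [stateEvent, jointEvent, Set.mem_inter_iff, Set.mem_ofPred_eq, Subtype.forall,
    Finset.mem_insert]
  constructor
  · intro H
    exact ⟨fun r hr => by simpa [hr] using H r (.inr hr), by simpa [hs] using H s (.inl rfl)⟩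
  · rintro ⟨h2, h1⟩ r hr
    by_cases h : r ∈ u
    · simp [h, h2 r h]
    · obtain rfl : r = s := hr.resolve_right h
      simp [h, h1]

theorem jointEvent_eq_inter_erase (Ω : Set (ℝ≥0 → X)) {u : Finset ℝ≥0} {t : ℝ≥0} (ht : t ∈ u)
    (xu : u → X) :
    jointEvent Ω u xu = stateEvent Ω t (xu ⟨t, ht⟩) ∩
      jointEvent Ω (u.erase t) (fun r => xu ⟨r.1, Finset.mem_of_mem_erase r.2⟩) := by
  ext ω
  simp only [stateEvent, jointEvent, Set.mem_inter_iff, Set.mem_ofPred_eq, Subtype.forall,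
    Finset.mem_erase]
  constructor
  · intro H
    exact ⟨H t ht, fun r hr => H r hr.2⟩
  · rintro ⟨h1, h2⟩ r hr
    by_cases h : r = t
    · subst h; exact h1
    · exact h2 r ⟨h, hr⟩

/-! ### Uniqueness -/

theorem congr_prob {Ω : Set (ℝ≥0 → X)} (P : domainSP Ω → ℝ) {A C A' C' : Set Ω}
    (h : (A, C) ∈ domainSP Ω) (hA : A = A') (hC : C = C') :
    P ⟨_, h⟩ = P ⟨(A', C'), hA ▸ hC ▸ h⟩ := by
  subst hA hC; rfl

variable {Ω : Set (ℝ≥0 → X)}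

/-- The largest time of `u` serves as the present and the rest as the history, so the Markov
property gives the same matrix entry for both processes. -/
theorem IsMarkovChain.prob_stateEvent_eq {P Q : domainSP Ω → ℝ} (hP : IsMarkovChain P)
    (hQ : IsMarkovChain Q) (hPQ : transitionFamily P = transitionFamily Q) {u : Finset ℝ≥0}
    (hu : u.Nonempty) (xu : u → X) {s : ℝ≥0} (hs : ∀ r ∈ u, r < s) (y : X)
    (h : (stateEvent Ω s y, jointEvent Ω u xu) ∈ domainSP Ω) : P ⟨_, h⟩ = Q ⟨_, h⟩ := by
  have ht := u.max'_mem hu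
  have hlt : ∀ r ∈ u.erase (u.max' hu), r < u.max' hu := fun r hr =>
    Finset.lt_max'_of_mem_erase_max' _ _ hr
  have e := jointEvent_eq_inter_erase Ω ht xu
  rw [congr_prob P h rfl e, congr_prob Q h rfl e]
  have h1 := hP.2 _ s (hs _ ht).le _ hlt (fun r => xu ⟨r.1, Finset.mem_of_mem_erase r.2⟩)
    (xu ⟨_, ht⟩) y
  have h2 := hQ.2 _ s (hs _ ht).le _ hlt (fun r => xu ⟨r.1, Finset.mem_of_mem_erase r.2⟩)
    (xu ⟨_, ht⟩) y
  rw [← hPQ] at h2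
  exact h1.trans h2.symm

theorem exists_forall_mem_stateEvent_iff (Ω : Set (ℝ≥0 → X)) (s : ℝ≥0) (ω : Ω) :
    ∃ z, ∀ y, ω ∈ stateEvent Ω s y ↔ y = z :=
  ⟨ω.1 s, fun _ => eq_comm⟩

variable [Fintype X]

/-- Two stochastic processes agree on `(A, X_u = x_u)` if they agree on the one-step
probabilities at the next time point `s` and on `A` given the state at `s`. -/
theorem prob_eq_of_step {P Q : domainSP Ω → ℝ} (hP : IsStochasticProcess P)
    (hQ : IsStochasticProcess Q) {u : Finset ℝ≥0} (xu : u → X) {s : ℝ≥0} (hs : ∀ r ∈ u, r < s)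
    {A : Set Ω} (hAs : A ∈ eventAlgebra Ω (insert s u))
    (h1 : ∀ y h, P ⟨(stateEvent Ω s y, jointEvent Ω u xu), h⟩ = Q ⟨_, h⟩)
    (h2 : ∀ (xv : ↥(insert s u) → X) h, P ⟨(A, jointEvent Ω (insert s u) xv), h⟩ = Q ⟨_, h⟩)
    (h : (A, jointEvent Ω u xu) ∈ domainSP Ω) : P ⟨_, h⟩ = Q ⟨_, h⟩ := by
  have hsu : s ∉ u := fun h => lt_irrefl _ (hs s h)
  have hBC : ∀ y, (stateEvent Ω s y, jointEvent Ω u xu) ∈ domainSP Ω := fun y =>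
    ⟨u, xu, .base _ ⟨s, y, .inr hs, rfl⟩, rfl⟩
  have hABC : ∀ y, (A, jointEvent Ω u xu ∩ stateEvent Ω s y) ∈ domainSP Ω := fun y => by
    obtain ⟨xv, hv⟩ := exists_jointEvent_insert Ω hsu xu y
    exact ⟨_, xv, hAs, hv.symm⟩
  rw [IsCoherent.total_prob hP (exists_forall_mem_stateEvent_iff Ω s) h hBC hABC,
    IsCoherent.total_prob hQ (exists_forall_mem_stateEvent_iff Ω s) h hBC hABC]
  refine Finset.sum_congr rfl fun y _ => ?_
  obtain ⟨xv, hv⟩ := exists_jointEvent_insert Ω hsu xu y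
  rw [h1, congr_prob P (hABC y) rfl hv.symm, congr_prob Q (hABC y) rfl hv.symm, h2]

/-- Induction on the future times `L`: the earliest one is moved into `u` by total probability. Once
`L` is empty, `X_u = x_u` decides `A`, and coherence fixes the value as `0` or `1`. -/
theorem IsMarkovChain.prob_eq_of_nonempty {P Q : domainSP Ω → ℝ} (hP : IsMarkovChain P)
    (hQ : IsMarkovChain Q) (hPQ : transitionFamily P = transitionFamily Q) {A : Set Ω}
    (L : List ℝ≥0) (hL : L.Pairwise (· < ·)) (u : Finset ℝ≥0) (hu : u.Nonempty)
    (huL : ∀ r ∈ u, ∀ l ∈ L, r < l) (xu : u → X)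
    (hA : A ∈ cylinderAlgebra Ω {t | t ∈ u ∨ t ∈ L})
    (h : (A, jointEvent Ω u xu) ∈ domainSP Ω) : P ⟨_, h⟩ = Q ⟨_, h⟩ := by
  induction L generalizing u with
  | nil =>
    have hne : (jointEvent Ω u xu).Nonempty := hP.1.1 _ h
    obtain ⟨η, hη⟩ := hne
    have key : ∀ ω ∈ jointEvent Ω u xu, A.indicator (fun _ => (1 : ℝ)) ω =
        A.indicator (fun _ => (1 : ℝ)) η := by
      intro ω hω
      have := mem_iff_of_mem_cylinderAlgebra hA (ω := ω) (η := η) fun t ht => by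
        have ht : t ∈ u := by simpa using ht
        exact (hω ⟨t, ht⟩).trans (hη ⟨t, ht⟩).symm
      by_cases hωA : ω ∈ A
      · rw [Set.indicator_of_mem hωA, Set.indicator_of_mem (this.1 hωA)]
      · rw [Set.indicator_of_notMem hωA, Set.indicator_of_notMem (mt this.2 hωA)]
    rw [IsCoherent.eq_of_indicator_eq hP.1 ⟨_, h⟩ _ key,
      IsCoherent.eq_of_indicator_eq hQ.1 ⟨_, h⟩ _ key]
  | cons s L ih =>
    rw [List.pairwise_cons] at hL
    have hs : ∀ r ∈ u, r < s := fun r hr => huL r hr s (by simp)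
    have hlt : ∀ r ∈ insert s u, ∀ l ∈ L, r < l := by
      intro r hr l hl
      rcases Finset.mem_insert.1 hr with rfl | hr
      · exact hL.1 l hl
      · exact huL r hr l (by simp [hl])
    have hA' : A ∈ cylinderAlgebra Ω {t | t ∈ insert s u ∨ t ∈ L} :=
      cylinderAlgebra_mono Ω (fun t ht => by
        simp only [Set.mem_ofPred_eq, List.mem_cons, Finset.mem_insert] at ht ⊢; tauto) hA
    refine prob_eq_of_step hP.1 hQ.1 xu hs
      (cylinderAlgebra_subset_eventAlgebra Ω (fun t ht => ?_) hA')
      (fun y h => hP.prob_stateEvent_eq hQ hPQ hu xu hs y h)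
      (fun xv h => ih hL.2 _ (by simp) hlt xv hA' h) h
    exact ht.imp_right fun ht r hr => hlt r hr t ht

theorem IsMarkovChain.eq_of_transitionFamily_eq {P Q : domainSP Ω → ℝ} (hP : IsMarkovChain P)
    (hQ : IsMarkovChain Q) (hPQ : transitionFamily P = transitionFamily Q)
    (h0 : ∀ y, stateProb P 0 y = stateProb Q 0 y) : P = Q := by
  classical
  funext ⟨⟨A, C⟩, h⟩
  obtain ⟨u, xu, hA, hC⟩ := id h
  obtain rfl : C = jointEvent Ω u xu := hC
  obtain ⟨F, hF, hAF⟩ := exists_finset_mem_cylinderAlgebra hA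
  rcases u.eq_empty_or_nonempty with rfl | hu
  -- Without a present state the Markov property says nothing, so the first step goes to time `0`,
  -- even if `A` does not involve it, and uses the initial distribution.
  · have hL : ((F.erase 0).sort).Pairwise (· < ·) := (Finset.sortedLT_sort _).pairwise
    have hA' : A ∈ cylinderAlgebra Ω {t | t ∈ insert (0 : ℝ≥0) (∅ : Finset ℝ≥0) ∨
        t ∈ (F.erase 0).sort} :=
      cylinderAlgebra_mono Ω (fun t ht => by
        simp only [SetLike.mem_coe] at ht
        by_cases h : t = 0 <;> simp [h, ht]) hAF
    have hlt : ∀ r ∈ insert (0 : ℝ≥0) (∅ : Finset ℝ≥0), ∀ l ∈ (F.erase 0).sort, r < l := by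
      intro r hr l hl
      simp only [insert_empty_eq, Finset.mem_singleton, Finset.mem_sort, Finset.mem_erase]
        at hr hl
      rw [hr]
      exact pos_iff_ne_zero.2 hl.1
    refine prob_eq_of_step hP.1 hQ.1 xu (s := 0) (by simp)
      (cylinderAlgebra_subset_eventAlgebra Ω
        (fun t ht => ht.imp_right fun ht r hr => hlt r hr t ht) hA')
      (fun y h => ?_)
      (fun xv h => hP.prob_eq_of_nonempty hQ hPQ _ hL _ (by simp) hlt xv hA' h) h
    have e : jointEvent Ω ∅ xu = Set.univ := by simp [jointEvent]
    rw [congr_prob P h rfl e, congr_prob Q h rfl e]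
    exact h0 y
  · refine hP.prob_eq_of_nonempty hQ hPQ (F \ u).sort (Finset.sortedLT_sort _).pairwise u hu
      ?_ xu (cylinderAlgebra_mono Ω (fun t ht => ?_) hAF) h
    · intro r hr l hl
      rw [Finset.mem_sort, Finset.mem_sdiff] at hl
      exact (hF l hl.1).resolve_left hl.2 r hr
    · simp only [SetLike.mem_coe] at ht
      by_cases h : t ∈ u <;> simp [h, ht]

/-! ### Well-behavedness -/

theorem limsup_coe_lt_top_iff {α : Type*} {l : Filter α} {f : α → ℝ} :
    limsup (fun a => (f a : EReal)) l < ⊤ ↔ ∃ M : ℝ, ∀ᶠ a in l, f a ≤ M := by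
  constructor
  · intro h
    obtain ⟨M, hM, -⟩ := EReal.lt_iff_exists_real_btwn.1 h
    exact ⟨M, (eventually_lt_of_limsup_lt hM).mono fun a ha => by exact_mod_cast ha.le⟩
  · rintro ⟨M, hM⟩
    refine lt_of_le_of_lt (limsup_le_of_le (by isBoundedDefault) (a := (M : EReal)) ?_)
      (EReal.coe_lt_top M)
    exact hM.mono fun a ha => by exact_mod_cast ha

theorem abs_entry_le_matNorm (A : Matrix X X ℝ) (x y : X) : |A x y| ≤ matNorm A := by
  classical
  let f : (X → ℝ) →L[ℝ] (X → ℝ) := ContinuousLinearMap.mk (Matrix.mulVecLin A)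
  have h1 : f (Pi.single y 1) x = A x y := by
    change A.mulVec (Pi.single y 1) x = A x y
    simp
  have h2 : ‖f (Pi.single y 1)‖ ≤ ‖f‖ * ‖(Pi.single y 1 : X → ℝ)‖ := f.le_opNorm _
  have h3 : ‖(Pi.single y 1 : X → ℝ)‖ ≤ 1 := by
    rw [pi_norm_le_iff_of_nonneg zero_le_one]
    intro i
    by_cases h : i = y
    · subst h; simp
    · simp [h]
  calc |A x y| = ‖f (Pi.single y 1) x‖ := by rw [h1, Real.norm_eq_abs]
    _ ≤ ‖f (Pi.single y 1)‖ := norm_le_pi_norm _ x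
    _ ≤ ‖f‖ * ‖(Pi.single y 1 : X → ℝ)‖ := h2
    _ ≤ ‖f‖ := mul_le_of_le_one_right (norm_nonneg _) h3

theorem matNorm_le_sum (A : Matrix X X ℝ) : matNorm A ≤ ∑ x, ∑ y, |A x y| := by
  refine ContinuousLinearMap.opNorm_le_bound _ (by positivity) fun v => ?_
  rw [pi_norm_le_iff_of_nonneg (by positivity)]
  intro x
  have h : ∑ y, |A x y| ≤ ∑ x, ∑ y, |A x y| :=
    Finset.single_le_sum (f := fun x => ∑ y, |A x y|) (fun _ _ => by positivity)
      (Finset.mem_univ x)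
  calc ‖(A.mulVec v) x‖ ≤ ∑ y, ‖A x y * v y‖ := norm_sum_le _ _
    _ ≤ ∑ y, |A x y| * ‖v‖ := Finset.sum_le_sum fun y _ => by
        rw [norm_mul, Real.norm_eq_abs]
        exact mul_le_mul_of_nonneg_left (norm_le_pi_norm v y) (abs_nonneg _)
    _ = (∑ y, |A x y|) * ‖v‖ := by rw [Finset.sum_mul]
    _ ≤ _ := mul_le_mul_of_nonneg_right h (norm_nonneg _)

/-- A difference quotient of matrices is bounded in norm if and only if its entries are. -/
theorem eventually_matNorm_le_iff (l : Filter ℝ≥0) (A : ℝ≥0 → Matrix X X ℝ) :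
    (∃ M : ℝ, ∀ᶠ Δ : ℝ≥0 in l, 1 / (Δ : ℝ) * matNorm (A Δ) ≤ M) ↔
      ∀ x y, ∃ M : ℝ, ∀ᶠ Δ : ℝ≥0 in l, 1 / (Δ : ℝ) * |A Δ x y| ≤ M := by
  constructor
  · rintro ⟨M, hM⟩ x y
    exact ⟨M, hM.mono fun Δ h =>
      (mul_le_mul_of_nonneg_left (abs_entry_le_matNorm _ x y) (by positivity)).trans h⟩
  · intro h
    choose M hM using h
    refine ⟨∑ x, ∑ y, M x y, ?_⟩
    have : ∀ᶠ Δ : ℝ≥0 in l, ∀ x y, 1 / (Δ : ℝ) * |A Δ x y| ≤ M x y := by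
      simpa only [eventually_all] using hM
    filter_upwards [this] with Δ hΔ
    refine (mul_le_mul_of_nonneg_left (matNorm_le_sum _) (by positivity)).trans ?_
    rw [Finset.mul_sum]
    refine Finset.sum_le_sum fun x _ => ?_
    rw [Finset.mul_sum]
    exact Finset.sum_le_sum fun y _ => hΔ x y

theorem eventually_forall_lt_sub {u : Finset ℝ≥0} {t : ℝ≥0} (hu : ∀ r ∈ u, r < t) :
    ∀ᶠ Δ in 𝓝[>] (0 : ℝ≥0), ∀ r ∈ u, r < t - Δ := by
  refine (Finset.eventually_all u).2 fun r hr => ?_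
  have : 0 < t - r := tsub_pos_of_lt (hu r hr)
  filter_upwards [nhdsWithin_le_nhds (Iio_mem_nhds this)] with Δ hΔ
  exact lt_tsub_comm.1 hΔ

theorem IsMarkovChain.isWellBehavedProcess_iff [DecidableEq X] {P : domainSP Ω → ℝ}
    (hP : IsMarkovChain P) :
    IsWellBehavedProcess P ↔ IsWellBehavedFamily (transitionFamily P) := by
  have hone : ∀ x y : X, (1 : Matrix X X ℝ) x y =
      @ite ℝ (y = x) (Classical.propDecidable _) 1 0 := by
    intro x y
    rw [Matrix.one_apply]
    split_ifs <;> simp_all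
  have hfwd : ∀ (t : ℝ≥0) {u : Finset ℝ≥0} (hu : ∀ r ∈ u, r < t) (xu : u → X) (x y : X) (Δ : ℝ≥0),
      |historyProb P (le_self_add : t ≤ t + Δ) hu xu x y
        - @ite ℝ (y = x) (Classical.propDecidable _) 1 0| =
      |(transitionFamily P t (t + Δ) le_self_add - 1) x y| := by
    intro t u hu xu x y Δ
    rw [hP.2, Matrix.sub_apply, hone]
  have hbwd : ∀ (t Δ : ℝ≥0) {u : Finset ℝ≥0} (hu : ∀ r ∈ u, r < t - Δ) (xu : u → X) (x y : X),
      |historyProb P (tsub_le_self : t - Δ ≤ t) hu xu x y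
        - @ite ℝ (y = x) (Classical.propDecidable _) 1 0| =
      |(transitionFamily P (t - Δ) t tsub_le_self - 1) x y| := by
    intro t Δ u hu xu x y
    rw [hP.2, Matrix.sub_apply, hone]
  -- For small `Δ` the condition `u < t - Δ` holds, so the default value does not affect the limsup.
  have hlim : ∀ (t : ℝ≥0) {u : Finset ℝ≥0} (_ : ∀ r ∈ u, r < t) (xu : u → X) (x y : X)
      (d : ∀ Δ, Decidable (∀ r ∈ u, r < t - Δ)),
      limsup (fun Δ : ℝ≥0 =>
        @dite EReal (∀ r ∈ u, r < t - Δ) (d Δ) (fun hΔ =>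
            (((1 / (Δ : ℝ)) *
              |historyProb P (tsub_le_self : t - Δ ≤ t) hΔ xu x y
                - @ite ℝ (y = x) (Classical.propDecidable _) 1 0| : ℝ) : EReal))
          (fun _ => 0)) (𝓝[>] (0 : ℝ≥0)) =
      limsup (fun Δ : ℝ≥0 => (((1 / (Δ : ℝ)) *
        |(transitionFamily P (t - Δ) t tsub_le_self - 1) x y| : ℝ) : EReal))
          (𝓝[>] (0 : ℝ≥0)) := by
    intro t u hu xu x y d
    refine limsup_congr ((eventually_forall_lt_sub hu).mono fun Δ hΔ => ?_)
    rw [dif_pos hΔ, hbwd]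
  simp only [IsWellBehavedProcess, IsWellBehavedFamily, limsup_coe_lt_top_iff,
    eventually_matNorm_le_iff]
  constructor
  · intro h
    -- The empty history suffices for this direction.
    have h' := fun x y t => h ∅ (fun _ => x) x y t (by simp)
    refine ⟨fun t x y => ?_, fun t ht x y => ?_⟩
    · simpa only [hfwd] using (h' x y t).1
    · have := (h' x y t).2 ht.ne'
      rwa [hlim t (by simp), limsup_coe_lt_top_iff] at this
  · intro h u xu x y t hu
    refine ⟨by simpa only [hfwd] using h.1 t x y, fun ht => ?_⟩
    rw [hlim t hu, limsup_coe_lt_top_iff]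
    exact h.2 t (pos_iff_ne_zero.2 ht) x y

/-! ### Iterated expectations along a finite grid -/

section PathExp

variable {X : Type*} [Fintype X]

/-- The expectation of `f` over the paths that follow `ω`, except that at the time points of the
list they are governed by the transition probabilities `K`, starting from state `x` at time `t`.
The time `⊥` precedes all others. -/
noncomputable def pathExp (K : WithBot ℝ≥0 → ℝ≥0 → X → X → ℝ) :
    List ℝ≥0 → WithBot ℝ≥0 → X → (ℝ≥0 → X) → ((ℝ≥0 → X) → ℝ) → ℝ
  | [], _, _, ω, f => f ω
  | s :: L, t, x, ω, f => ∑ y, K t s x y * pathExp K L s y (Function.update ω s y) f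

variable {K : WithBot ℝ≥0 → ℝ≥0 → X → X → ℝ}

theorem isLinearMap_pathExp (L : List ℝ≥0) (t : WithBot ℝ≥0) (x : X) (ω : ℝ≥0 → X) :
    IsLinearMap ℝ (pathExp K L t x ω) := by
  induction L generalizing t x ω with
  | nil => exact ⟨fun _ _ => rfl, fun _ _ => rfl⟩
  | cons s L ih =>
    constructor
    · intro f g
      simp only [pathExp, (ih _ _ _).map_add, mul_add, Finset.sum_add_distrib]
    · intro a f
      simp only [pathExp, (ih _ _ _).map_smul, smul_eq_mul, Finset.mul_sum]
      exact Finset.sum_congr rfl fun y _ => by ring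

theorem pathExp_mono (hK : ∀ t s x y, 0 ≤ K t s x y) (L : List ℝ≥0) (t : WithBot ℝ≥0) (x : X)
    (ω : ℝ≥0 → X) {f g : (ℝ≥0 → X) → ℝ} (h : f ≤ g) : pathExp K L t x ω f ≤ pathExp K L t x ω g := by
  induction L generalizing t x ω with
  | nil => exact h ω
  | cons s L ih =>
    exact Finset.sum_le_sum fun y _ => mul_le_mul_of_nonneg_left (ih _ _ _) (hK _ _ _ _)

theorem pathExp_nonneg (hK : ∀ t s x y, 0 ≤ K t s x y) (L : List ℝ≥0) (t : WithBot ℝ≥0) (x : X)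
    (ω : ℝ≥0 → X) {f : (ℝ≥0 → X) → ℝ} (h : 0 ≤ f) : 0 ≤ pathExp K L t x ω f := by
  have := pathExp_mono hK L t x ω h
  rwa [(isLinearMap_pathExp L t x ω).map_zero] at this

/-- The branch that follows `η` at every grid point has positive weight and ends in `η`; all other
branches contribute non-negatively. -/
theorem pathExp_pos (hK : ∀ t s x y, 0 < K t s x y) (L : List ℝ≥0) (t : WithBot ℝ≥0) (x : X)
    {ω η : ℝ≥0 → X} (hη : ∀ r ∉ L, η r = ω r) {f : (ℝ≥0 → X) → ℝ} (h : 0 ≤ f) (hf : 0 < f η) :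
    0 < pathExp K L t x ω f := by
  induction L generalizing t x ω with
  | nil =>
    obtain rfl : η = ω := funext fun r => hη r (by simp)
    exact hf
  | cons s L ih =>
    refine Finset.sum_pos' (fun y _ => mul_nonneg (hK _ _ _ _).le
      (pathExp_nonneg (fun _ _ _ _ => (hK _ _ _ _).le) _ _ _ _ h))
      ⟨η s, Finset.mem_univ _, mul_pos (hK _ _ _ _) (ih _ _ fun r hr => ?_)⟩
    by_cases hrs : r = s
    · subst hrs; simp
    · rw [Function.update_of_ne hrs]
      exact hη r (by simp [hrs, hr])

theorem pathExp_const (hK : ∀ t s x, ∑ y, K t s x y = 1) (L : List ℝ≥0) (t : WithBot ℝ≥0) (x : X)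
    (ω : ℝ≥0 → X) (a : ℝ) : pathExp K L t x ω (fun _ => a) = a := by
  induction L generalizing t x ω with
  | nil => rfl
  | cons s L ih => simp only [pathExp, ih, ← Finset.sum_mul, hK, one_mul]

/-- The iterated sum can be cut at `s`: what comes after uses only the state at `s` and the path
built so far. -/
theorem pathExp_append (L M : List ℝ≥0) (s : ℝ≥0) (t : WithBot ℝ≥0) (x : X) (ω : ℝ≥0 → X)
    (f : (ℝ≥0 → X) → ℝ) :
    pathExp K (L ++ s :: M) t x ω f =
      pathExp K (L ++ [s]) t x ω (fun η => pathExp K M s (η s) η f) := by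
  induction L generalizing t x ω with
  | nil => simp [pathExp]
  | cons r L ih => simp only [List.cons_append, pathExp, ih]

/-- A factor that does not depend on the time points of the list can be pulled out. -/
theorem pathExp_mul_left (L : List ℝ≥0) (t : WithBot ℝ≥0) (x : X) (ω : ℝ≥0 → X)
    {f : (ℝ≥0 → X) → ℝ} (hf : ∀ η ζ : ℝ≥0 → X, (∀ r ∉ L, η r = ζ r) → f η = f ζ)
    (g : (ℝ≥0 → X) → ℝ) :
    pathExp K L t x ω (fun η => f η * g η) = f ω * pathExp K L t x ω g := by
  induction L generalizing t x ω with
  | nil => rfl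
  | cons s L ih =>
    simp only [pathExp, Finset.mul_sum]
    refine Finset.sum_congr rfl fun y _ => ?_
    rw [ih _ _ _ fun η ζ h => hf η ζ fun r hr => h r (fun h => hr (by simp [h])),
      hf (Function.update ω s y) ω fun r hr => Function.update_of_ne (by
        rintro rfl; simp at hr) _ _]
    ring

/-- The points of `L` are overwritten, so only the values on `S` matter. This frees the expectation
over the future from the path before it. -/
theorem pathExp_congr_path (L : List ℝ≥0) (t : WithBot ℝ≥0) (x : X) {ω η : ℝ≥0 → X}
    (S : Set ℝ≥0) (hS : ∀ r ∈ S, ω r = η r) {f : (ℝ≥0 → X) → ℝ}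
    (hf : ∀ ω η : ℝ≥0 → X, (∀ r, r ∈ S ∨ r ∈ L → ω r = η r) → f ω = f η) :
    pathExp K L t x ω f = pathExp K L t x η f := by
  induction L generalizing t x ω η S with
  | nil => exact hf _ _ (by simpa using hS)
  | cons s L ih =>
    refine Finset.sum_congr rfl fun y _ => ?_
    rw [ih _ _ (insert s S) (fun r hr => ?_) fun ω η h => hf ω η fun r hr => h r ?_]
    · by_cases hrs : r = s
      · subst hrs; simp
      · rw [Function.update_of_ne hrs, Function.update_of_ne hrs]
        exact hS r (hr.resolve_left hrs)
    · simp only [List.mem_cons, Set.mem_insert_iff] at hr ⊢; tauto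

theorem tendsto_pathExp {α : Type*} {l : Filter α} {κ : α → WithBot ℝ≥0 → ℝ≥0 → X → X → ℝ}
    (h : ∀ t s x y, Tendsto (fun a => κ a t s x y) l (𝓝 (K t s x y)))
    (L : List ℝ≥0) (t : WithBot ℝ≥0) (x : X) (ω : ℝ≥0 → X) (f : (ℝ≥0 → X) → ℝ) :
    Tendsto (fun a => pathExp (κ a) L t x ω f) l (𝓝 (pathExp K L t x ω f)) := by
  induction L generalizing t x ω with
  | nil => exact tendsto_const_nhds
  | cons s L ih => exact tendsto_finsetSum _ fun y _ => (h _ _ _ _).mul (ih _ _ _)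

/-- Under the Chapman-Kolmogorov equations the intermediate grid points are immaterial for the
probability of a state. -/
theorem pathExp_state [DecidableEq X] (hK : ∀ t s x, ∑ y, K t s x y = 1)
    (hCK : ∀ (t : WithBot ℝ≥0) (r s : ℝ≥0), t < r → r < s → ∀ x y,
      ∑ z, K t r x z * K r s z y = K t s x y)
    (L : List ℝ≥0) (hL : L.Pairwise (· < ·)) (t : WithBot ℝ≥0) (htL : ∀ r ∈ L, t < r)
    (x : X) (ω : ℝ≥0 → X) {s : ℝ≥0} (hs : s ∈ L) (y : X) :
    pathExp K L t x ω (fun η => if η s = y then 1 else 0) = K t s x y := by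
  induction L generalizing t x ω with
  | nil => simp at hs
  | cons r L ih =>
    rw [List.pairwise_cons] at hL
    rcases List.mem_cons.1 hs with rfl | hs
    · have hsL : s ∉ L := fun h => lt_irrefl _ (hL.1 s h)
      -- The times after `s` do not affect the indicator, and their weights sum to one.
      have key : ∀ z, pathExp K L s z (Function.update ω s z)
          (fun η => if η s = y then (1 : ℝ) else 0) = if z = y then 1 else 0 := by
        intro z
        have := pathExp_mul_left (K := K) L s z (Function.update ω s z)
          (f := fun η => if η s = y then (1 : ℝ) else 0)
          (fun η ζ h => by rw [h s hsL]) (fun _ => 1)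
        simpa [pathExp_const hK] using this
      simp [pathExp, key]
    · simp only [pathExp]
      rw [← hCK t r s (htL r (by simp)) (hL.1 s hs)]
      refine Finset.sum_congr rfl fun z _ => ?_
      rw [ih hL.2 _ (fun q hq => by exact_mod_cast hL.1 q hq) _ _ hs]

end PathExp

/-! ### The kernel of a transition matrix system and its perturbations -/

section Kernel

variable {X : Type*} [Fintype X]

/-- The transition probabilities of a transition matrix system, with the distribution `p` of the
state at time `0` encoded by transitions from the time `⊥`. -/
noncomputable def kernel (p : X → ℝ) (T : MatrixFamily X) : WithBot ℝ≥0 → ℝ≥0 → X → X → ℝ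
  | ⊥, s, _, y => ∑ z, p z * T 0 s zero_le z y
  -- The value for `t > s` only keeps the rows stochastic, so that positivity and row sums need no
  -- order hypothesis.
  | (t : ℝ≥0), s, x, y => if h : t ≤ s then T t s h x y else T t t le_rfl x y

/-- The mixture of transition probabilities with the uniform distribution. -/
noncomputable def perturb (K : WithBot ℝ≥0 → ℝ≥0 → X → X → ℝ) (ε : ℝ) :
    WithBot ℝ≥0 → ℝ≥0 → X → X → ℝ :=
  fun t s x y => (1 - ε) * K t s x y + ε * (Fintype.card X : ℝ)⁻¹

theorem kernel_coe {p : X → ℝ} {T : MatrixFamily X} {t s : ℝ≥0} (h : t ≤ s) (x y : X) :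
    kernel p T t s x y = T t s h x y := dif_pos h

section

variable [DecidableEq X] {p : X → ℝ} {T : MatrixFamily X}

theorem kernel_nonneg (hp : ∀ x, 0 ≤ p x) (hT : IsTransitionMatrixSystem T)
    (t : WithBot ℝ≥0) (s : ℝ≥0) (x y : X) : 0 ≤ kernel p T t s x y := by
  induction t with
  | bot => exact Finset.sum_nonneg fun z _ => mul_nonneg (hp z) (hT.nonneg _ _ _ _ _)
  | coe t =>
    by_cases h : t ≤ s
    · rw [kernel_coe h]; exact hT.nonneg _ _ _ _ _
    · simp only [kernel, dif_neg h]; exact hT.nonneg _ _ _ _ _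

theorem sum_kernel (hp : ∑ x, p x = 1) (hT : IsTransitionMatrixSystem T)
    (t : WithBot ℝ≥0) (s : ℝ≥0) (x : X) : ∑ y, kernel p T t s x y = 1 := by
  induction t with
  | bot =>
    simp only [kernel]
    rw [Finset.sum_comm]
    simp only [← Finset.mul_sum, hT.sum_one, mul_one, hp]
  | coe t =>
    by_cases h : t ≤ s
    · simp only [kernel_coe h, hT.sum_one]
    · simp only [kernel, dif_neg h, hT.sum_one]

theorem kernel_chapmanKolmogorov (hT : IsTransitionMatrixSystem T) (t : WithBot ℝ≥0) (r s : ℝ≥0)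
    (htr : t < r) (hrs : r < s) (x y : X) :
    ∑ z, kernel p T t r x z * kernel p T r s z y = kernel p T t s x y := by
  induction t with
  | bot =>
    simp only [kernel_coe hrs.le]
    simp only [kernel, Finset.sum_mul]
    rw [Finset.sum_comm]
    refine Finset.sum_congr rfl fun w _ => ?_
    rw [hT.semigroup 0 r s zero_le hrs.le, Matrix.mul_apply, Finset.mul_sum]
    exact Finset.sum_congr rfl fun z _ => by ring
  | coe t =>
    have htr : t ≤ r := by exact_mod_cast htr.le
    simp only [kernel_coe hrs.le, kernel_coe htr, kernel_coe (htr.trans hrs.le)]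
    rw [hT.semigroup t r s htr hrs.le, Matrix.mul_apply]

theorem kernel_bot_zero (hT : IsTransitionMatrixSystem T) (x y : X) :
    kernel p T ⊥ 0 x y = p y := by
  simp [kernel, hT.self_eq_one, Matrix.one_apply]

end

variable {K : WithBot ℝ≥0 → ℝ≥0 → X → X → ℝ}

theorem perturb_pos [Nonempty X] (hK : ∀ t s x y, 0 ≤ K t s x y) {ε : ℝ} (h0 : 0 < ε)
    (h1 : ε < 1) (t : WithBot ℝ≥0) (s : ℝ≥0) (x y : X) : 0 < perturb K ε t s x y := by
  have : (0 : ℝ) < Fintype.card X := by exact_mod_cast Fintype.card_pos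
  exact add_pos_of_nonneg_of_pos (mul_nonneg (by linarith) (hK _ _ _ _)) (by positivity)

theorem sum_perturb [Nonempty X] (hK : ∀ t s x, ∑ y, K t s x y = 1) (ε : ℝ)
    (t : WithBot ℝ≥0) (s : ℝ≥0) (x : X) : ∑ y, perturb K ε t s x y = 1 := by
  have : (Fintype.card X : ℝ) ≠ 0 := by exact_mod_cast Fintype.card_ne_zero
  simp only [perturb, Finset.sum_add_distrib, ← Finset.mul_sum, hK, Finset.sum_const,
    Finset.card_univ, nsmul_eq_mul]
  field_simp
  ring

theorem tendsto_perturb (K : WithBot ℝ≥0 → ℝ≥0 → X → X → ℝ) (t : WithBot ℝ≥0) (s : ℝ≥0) (x y : X) :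
    Tendsto (fun ε => perturb K ε t s x y) (𝓝[>] 0) (𝓝 (K t s x y)) := by
  have : Continuous fun ε => perturb K ε t s x y := by unfold perturb; fun_prop
  simpa [perturb] using (this.tendsto 0).mono_left nhdsWithin_le_nhds

end Kernel

/-! ### Conditional probabilities on a finite grid -/

section Grid

variable {X : Type*} [Fintype X] {Ω : Set (ℝ≥0 → X)} {K : WithBot ℝ≥0 → ℝ≥0 → X → X → ℝ}

/-- The expectation of a function on `Ω` along the grid `G`, where `ρ` picks a path in `Ω`
with given states at the time points of the grid. -/
noncomputable def gridExp (K : WithBot ℝ≥0 → ℝ≥0 → X → X → ℝ) (G : Finset ℝ≥0)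
    (ρ : (ℝ≥0 → X) → Ω) (x₀ : X) (f : Ω → ℝ) : ℝ :=
  pathExp K G.sort ⊥ x₀ (fun _ => x₀) (fun η => f (ρ η))

/-- The conditional probability along the grid `G`, by Bayes' rule. -/
noncomputable def gridProb (K : WithBot ℝ≥0 → ℝ≥0 → X → X → ℝ) (G : Finset ℝ≥0)
    (ρ : (ℝ≥0 → X) → Ω) (x₀ : X) (A C : Set Ω) : ℝ :=
  gridExp K G ρ x₀ (fun ω => C.indicator (fun _ => 1) ω * A.indicator (fun _ => 1) ω) /
    gridExp K G ρ x₀ (C.indicator fun _ => 1)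

variable {G : Finset ℝ≥0} {ρ : (ℝ≥0 → X) → Ω} {x₀ : X}

theorem gridExp_isLinearMap : IsLinearMap ℝ (gridExp K G ρ x₀) :=
  ⟨fun _ _ => (isLinearMap_pathExp _ _ _ _).map_add _ _,
    fun _ _ => (isLinearMap_pathExp _ _ _ _).map_smul _ _⟩

/-- Also valid for a vanishing denominator, since division by zero gives `0`; hence all values lie
in one compact cube. -/
theorem gridProb_mem_Icc (hK : ∀ t s x y, 0 ≤ K t s x y) (A C : Set Ω) :
    gridProb K G ρ x₀ A C ∈ Set.Icc (0 : ℝ) 1 := by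
  have hC : ∀ (B : Set Ω) (ω : Ω), 0 ≤ B.indicator (fun _ => (1 : ℝ)) ω := fun B ω =>
    Set.indicator_nonneg (fun _ _ => zero_le_one) ω
  have h0 : 0 ≤ gridExp K G ρ x₀ (C.indicator fun _ => 1) :=
    pathExp_nonneg hK _ _ _ _ fun η => hC C (ρ η)
  refine ⟨div_nonneg (pathExp_nonneg hK _ _ _ _ fun η => mul_nonneg (hC C _) (hC A _)) h0,
    div_le_one_of_le₀ (pathExp_mono hK _ _ _ _ fun η => ?_) h0⟩
  exact mul_le_of_le_one_right (hC C _) (Set.indicator_le_self' (fun _ _ => zero_le_one) _)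

/-- The grid expectation of a non-negative function is positive if the function is positive
on a joint event of the grid. -/
theorem gridExp_pos (hK : ∀ t s x y, 0 < K t s x y) (hρ : ∀ η, ∀ t ∈ G, (ρ η).1 t = η t)
    {u : Finset ℝ≥0} (hu : u ⊆ G) (xu : u → X) {f : Ω → ℝ} (hf : 0 ≤ f)
    (hfu : ∀ ω ∈ jointEvent Ω u xu, 0 < f ω) : 0 < gridExp K G ρ x₀ f := by
  classical
  -- The witness follows `xu` on `u` and the base path elsewhere, so it differs from the base path
  -- only on the grid.
  refine pathExp_pos hK _ _ _ (η := fun r => if h : r ∈ u then xu ⟨r, h⟩ else x₀) (fun r hr => ?_)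
    (fun η => hf _) (hfu _ fun r => ?_)
  · rw [Finset.mem_sort] at hr
    exact dif_neg fun h => hr (hu h)
  · rw [hρ _ _ (hu r.2)]
    simp

theorem gridExp_jointEvent_pos (hK : ∀ t s x y, 0 < K t s x y)
    (hρ : ∀ η, ∀ t ∈ G, (ρ η).1 t = η t) {u : Finset ℝ≥0} (hu : u ⊆ G) (xu : u → X) :
    0 < gridExp K G ρ x₀ ((jointEvent Ω u xu).indicator fun _ => 1) :=
  gridExp_pos hK hρ hu xu (fun _ => Set.indicator_nonneg (fun _ _ => zero_le_one) _)
    fun ω hω => by simp [hω]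

theorem gridExp_history_pos (hK : ∀ t s x y, 0 < K t s x y)
    (hρ : ∀ η, ∀ t ∈ G, (ρ η).1 t = η t) {t : ℝ≥0} (ht : t ∈ G) {u : Finset ℝ≥0} (huG : u ⊆ G)
    (hut : ∀ r ∈ u, r < t) (xu : u → X) (x : X) :
    0 < gridExp K G ρ x₀ ((stateEvent Ω t x ∩ jointEvent Ω u xu).indicator fun _ => 1) := by
  obtain ⟨xv, hv⟩ := exists_jointEvent_insert Ω (fun h => lt_irrefl _ (hut t h)) xu x
  rw [Set.inter_comm, ← hv]
  exact gridExp_jointEvent_pos hK hρ (Finset.insert_subset ht huG) xv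

/-- The coherence condition for joint events of the grid. -/
theorem gridProb_coherent (hK : ∀ t s x y, 0 < K t s x y) (hρ : ∀ η, ∀ t ∈ G, (ρ η).1 t = η t)
    {n : ℕ} (hn : 0 < n) (c : Fin n → Set Ω × Set Ω) (l : Fin n → ℝ)
    (hc : ∀ i, ∃ u ⊆ G, ∃ xu, (c i).2 = jointEvent Ω u xu) :
    ∃ ω ∈ ⋃ i, (c i).2, 0 ≤ ∑ i, l i * (c i).2.indicator (fun _ => (1 : ℝ)) ω *
        (gridProb K G ρ x₀ (c i).1 (c i).2 - (c i).1.indicator (fun _ => (1 : ℝ)) ω) := by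
  -- By Bayes' rule each gamble has expectation zero, whatever the events `A_i`. If the total were
  -- negative on the whole union, its negative would be non-negative everywhere and positive on a
  -- joint event of positive weight, hence of positive expectation.
  by_contra! hneg
  let S : Fin n → Ω → ℝ := fun i ω => (c i).2.indicator (fun _ => (1 : ℝ)) ω *
        (gridProb K G ρ x₀ (c i).1 (c i).2 - (c i).1.indicator (fun _ => (1 : ℝ)) ω)
  let Λ := gridExp_isLinearMap (K := K) (G := G) (ρ := ρ) (x₀ := x₀).mk'
  have hS : ∀ i, Λ (S i) = 0 := by
    intro i
    obtain ⟨u, hu, xu, hxu⟩ := hc i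
    have hpos : 0 < Λ ((c i).2.indicator fun _ => 1) := by
      rw [hxu]; exact gridExp_jointEvent_pos hK hρ hu xu
    have e : S i = gridProb K G ρ x₀ (c i).1 (c i).2 • ((c i).2.indicator fun _ => 1) -
        fun ω => (c i).2.indicator (fun _ => 1) ω * (c i).1.indicator (fun _ => 1) ω := by
      funext ω
      simp only [S, Pi.sub_apply, Pi.smul_apply, smul_eq_mul]
      ring
    rw [e, map_sub, map_smul, smul_eq_mul, sub_eq_zero]
    exact div_mul_cancel₀ _ hpos.ne'
  have h0 : Λ (-∑ i, l i • S i) = 0 := by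
    simp [map_neg, map_sum, map_smul, hS]
  have hval : ∀ ω, (-∑ i, l i • S i) ω = -∑ i, l i * (c i).2.indicator (fun _ => (1 : ℝ)) ω *
        (gridProb K G ρ x₀ (c i).1 (c i).2 - (c i).1.indicator (fun _ => (1 : ℝ)) ω) := by
    intro ω
    simp [S, Finset.sum_apply, mul_assoc]
  obtain ⟨u, hu, xu, hxu⟩ := hc ⟨0, hn⟩
  have hpos : 0 < Λ (-∑ i, l i • S i) := by
    refine gridExp_pos hK hρ hu xu (fun ω => ?_) fun ω hω => ?_
    · rw [hval]
      by_cases hω : ω ∈ ⋃ i, (c i).2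
      · simpa using (hneg ω hω).le
      · have : ∀ i, ω ∉ (c i).2 := by simpa using hω
        simp [this]
    · rw [hval, neg_pos]
      exact hneg ω (Set.mem_iUnion.2 ⟨⟨0, hn⟩, by rwa [hxu]⟩)
  exact hpos.ne' h0

/-- The history is irrelevant for the conditional probability of a future state. -/
theorem gridProb_history [DecidableEq X] (hK : ∀ t s x y, 0 < K t s x y)
    (hK' : ∀ t s x, ∑ y, K t s x y = 1) (hρ : ∀ η, ∀ t ∈ G, (ρ η).1 t = η t) {t s : ℝ≥0} {L M : List ℝ≥0}
    (hG : G.sort = L ++ t :: M) (hs : s ∈ M)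
    {u : Finset ℝ≥0} (huG : u ⊆ G) (hut : ∀ r ∈ u, r < t) (xu : u → X) (x y : X) :
    gridProb K G ρ x₀ (stateEvent Ω s y) (stateEvent Ω t x ∩ jointEvent Ω u xu) =
      pathExp K M t x (fun _ => x₀) (fun η => if η s = y then 1 else 0) := by
  classical
  have hsorted : (L ++ t :: M).Pairwise (· < ·) := hG ▸ (Finset.sortedLT_sort G).pairwise
  have htM : ∀ r ∈ M, t < r := by
    have := (List.pairwise_append.1 hsorted).2.1
    rw [List.pairwise_cons] at this
    exact this.1
  have htG : t ∈ G := by rw [← Finset.mem_sort (r := (· ≤ ·)), hG]; simp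
  have hsG : s ∈ G := by rw [← Finset.mem_sort (r := (· ≤ ·)), hG]; simp [hs]
  set C := stateEvent Ω t x ∩ jointEvent Ω u xu with hC
  let φ : (ℝ≥0 → X) → ℝ := fun η => C.indicator (fun _ => 1) (ρ η)
  have hmem : ∀ η, ρ η ∈ C ↔ η t = x ∧ ∀ r : u, η r = xu r := by
    intro η
    simp only [hC, stateEvent, jointEvent, Set.mem_inter_iff, Set.mem_ofPred_eq, hρ η t htG]
    refine and_congr_right fun _ => forall_congr' fun r => ?_
    rw [hρ η r (huG r.2)]
  -- The conditioning event depends only on times up to `t`, so its indicator factors out of the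
  -- expectation over `M`.
  have hφ : ∀ η ζ : ℝ≥0 → X, (∀ r ∉ M, η r = ζ r) → φ η = φ ζ := by
    intro η ζ h
    have : ρ η ∈ C ↔ ρ ζ ∈ C := by
      rw [hmem, hmem, h t fun ht => lt_irrefl _ (htM t ht)]
      refine and_congr_right fun _ => forall_congr' fun r => ?_
      rw [h r fun hr => lt_asymm (hut r r.2) (htM r hr)]
    simp only [φ, Set.indicator_apply, this]
  have hψ : ∀ η, (stateEvent Ω s y).indicator (fun _ => (1 : ℝ)) (ρ η) =
      if η s = y then 1 else 0 := by
    intro η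
    simp only [Set.indicator_apply, stateEvent, Set.mem_ofPred_eq, hρ η s hsG]
  set Z := pathExp K M t x (fun _ => x₀) (fun η => if η s = y then 1 else 0) with hZ
  have hpos : 0 < gridExp K G ρ x₀ (C.indicator fun _ => 1) :=
    gridExp_history_pos hK hρ htG huG hut xu x
  rw [gridProb, div_eq_iff hpos.ne']
  have h1 : gridExp K G ρ x₀ (C.indicator fun _ => 1) =
      pathExp K (L ++ [t]) ⊥ x₀ (fun _ => x₀) φ := by
    rw [gridExp, hG, pathExp_append]
    congr 1
    funext η
    have := pathExp_mul_left (K := K) M t (η t) η hφ (fun _ => 1)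
    simpa [pathExp_const hK'] using this
  have h2 : gridExp K G ρ x₀ (fun ω => C.indicator (fun _ => 1) ω *
        (stateEvent Ω s y).indicator (fun _ => 1) ω) =
      pathExp K (L ++ [t]) ⊥ x₀ (fun _ => x₀) (Z • φ) := by
    rw [gridExp, hG, pathExp_append]
    congr 1
    funext η
    simp only [hψ]
    refine (pathExp_mul_left M t (η t) η hφ _).trans ?_
    rw [Pi.smul_apply, smul_eq_mul, mul_comm Z]
    -- On `C` the state at `t` is `x`, so the future expectation is the constant `Z`; off `C` both
    -- sides vanish. Chapman-Kolmogorov is not needed, so this applies to perturbed kernels.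
    by_cases hη : ρ η ∈ C
    · rw [((hmem η).1 hη).1, hZ]
      refine congrArg _ (pathExp_congr_path M t x ∅ (by simp) fun ω η h => ?_)
      rw [h s (.inr hs)]
    · simp [φ, hη]
  rw [h1, h2, (isLinearMap_pathExp _ _ _ _).map_smul, smul_eq_mul]

theorem gridProb_of_indicator_eq {A C : Set Ω} (hC : gridExp K G ρ x₀ (C.indicator fun _ => 1) ≠ 0)
    {a : ℝ} (h : ∀ ω ∈ C, A.indicator (fun _ => (1 : ℝ)) ω = a) : gridProb K G ρ x₀ A C = a := by
  have e : (fun ω => C.indicator (fun _ => (1 : ℝ)) ω * A.indicator (fun _ => 1) ω) =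
      a • C.indicator fun _ => 1 := by
    funext ω
    by_cases hω : ω ∈ C
    · simp [h ω hω, hω]
    · simp [hω]
  rw [gridProb, e, gridExp_isLinearMap.map_smul, smul_eq_mul, mul_div_cancel_right₀ _ hC]

theorem gridProb_univ [DecidableEq X] (hK' : ∀ t s x, ∑ y, K t s x y = 1)
    (hρ : ∀ η, ∀ t ∈ G, (ρ η).1 t = η t) {s : ℝ≥0} (hs : s ∈ G) (y : X) :
    gridProb K G ρ x₀ (stateEvent Ω s y) Set.univ =
      pathExp K G.sort ⊥ x₀ (fun _ => x₀) (fun η => if η s = y then 1 else 0) := by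
  have h1 : gridExp K G ρ x₀ (Set.univ.indicator fun _ => 1) = 1 := by
    simpa [gridExp] using pathExp_const hK' G.sort ⊥ x₀ (fun _ => x₀) 1
  rw [gridProb, h1, div_one, gridExp]
  congr 1
  funext η
  simp [Set.indicator_apply, stateEvent, hρ η s hs]

end Grid

/-! ### Existence -/

section Existence

/-- The path enters only through its membership pattern in the finitely many events, so this is a
finite union of closed sets given by affine inequalities. -/
theorem isClosed_setOf_coherentAt {Ω : Type*} {𝒞 : Set (Set Ω × Set Ω)} {n : ℕ} (c : Fin n → 𝒞)
    (l : Fin n → ℝ) :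
    IsClosed {P : 𝒞 → ℝ | ∃ ω ∈ ⋃ i, (c i).1.2,
      0 ≤ ∑ i, l i * (c i).1.2.indicator (fun _ => (1 : ℝ)) ω *
        (P (c i) - (c i).1.1.indicator (fun _ => (1 : ℝ)) ω)} := by
  classical
  let pat : Ω → Fin n → Prop × Prop := fun ω i => (ω ∈ (c i).1.1, ω ∈ (c i).1.2)
  have e : {P : 𝒞 → ℝ | ∃ ω ∈ ⋃ i, (c i).1.2,
      0 ≤ ∑ i, l i * (c i).1.2.indicator (fun _ => (1 : ℝ)) ω *
        (P (c i) - (c i).1.1.indicator (fun _ => (1 : ℝ)) ω)} =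
      ⋃ b ∈ pat '' ⋃ i, (c i).1.2, {P : 𝒞 → ℝ | 0 ≤ ∑ i, l i * (if (b i).2 then 1 else 0) *
        (P (c i) - if (b i).1 then 1 else 0)} := by
    ext P
    simp only [Set.biUnion_image, Set.mem_iUnion₂, exists_prop, Set.indicator_apply, pat]
    rfl
  rw [e]
  refine (Set.toFinite _).isClosed_biUnion fun b _ => isClosed_le continuous_const ?_
  fun_prop

/-- Tychonoff: the cube is compact, so along an ultrafilter all coordinates converge at once. -/
theorem exists_mem_le_nhds_of_forall_mem_Icc {α ι : Type*} (U : Ultrafilter α) (Q : α → ι → ℝ)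
    (h : ∀ᶠ a in (U : Filter α), ∀ i, Q a i ∈ Set.Icc (0 : ℝ) 1) :
    ∃ P : ι → ℝ, (∀ i, P i ∈ Set.Icc (0 : ℝ) 1) ∧ Tendsto Q U (𝓝 P) := by
  have hc : IsCompact (Set.univ.pi fun _ : ι => Set.Icc (0 : ℝ) 1) :=
    isCompact_univ_pi fun _ => isCompact_Icc
  obtain ⟨P, hP, hle⟩ := hc.ultrafilter_le_nhds' (U.map Q) (by
    rw [Ultrafilter.mem_map]
    exact h.mono fun a ha i _ => ha i)
  exact ⟨P, fun i => hP i trivial, hle⟩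

variable {X : Type*} {Ω : Set (ℝ≥0 → X)}

theorem IsRichPathSpace.exists_section (hΩ : IsRichPathSpace Ω) {G : Finset ℝ≥0}
    (hG : G.Nonempty) : ∃ ρ : (ℝ≥0 → X) → Ω, ∀ η, ∀ t ∈ G, (ρ η).1 t = η t := by
  choose ρ hρ h using fun η : ℝ≥0 → X => hΩ G hG fun t => η t
  exact ⟨fun η => ⟨ρ η, hρ η⟩, fun η t ht => h η ⟨t, ht⟩⟩

variable [Fintype X] [DecidableEq X] {p : X → ℝ} {T : MatrixFamily X}

/-- The properties required of a Markov chain, restricted to the time points of a grid. -/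
theorem exists_grid_assessment (hΩ : IsRichPathSpace Ω) (hp : ∀ x, 0 ≤ p x)
    (hp' : ∑ x, p x = 1) (hT : IsTransitionMatrixSystem T) {G : Finset ℝ≥0} (hG : 0 ∈ G) :
    ∃ P : domainSP Ω → ℝ, (∀ c, P c ∈ Set.Icc (0 : ℝ) 1) ∧
      (∀ n, 0 < n → ∀ (c : Fin n → domainSP Ω) (l : Fin n → ℝ),
        (∀ i, ∃ u ⊆ G, ∃ xu, (c i).1.2 = jointEvent Ω u xu) →
        ∃ ω ∈ ⋃ i, (c i).1.2, 0 ≤ ∑ i, l i * (c i).1.2.indicator (fun _ => (1 : ℝ)) ω *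
          (P (c i) - (c i).1.1.indicator (fun _ => (1 : ℝ)) ω)) ∧
      (∀ (t s : ℝ≥0) (hts : t ≤ s) (u : Finset ℝ≥0) (hu : ∀ r ∈ u, r < t) (xu : u → X) (x y : X),
        t ∈ G → s ∈ G → u ⊆ G → historyProb P hts hu xu x y = T t s hts x y) ∧
      ∀ y, stateProb P 0 y = p y := by
  have hX : Nonempty X := by
    by_contra h
    rw [not_nonempty_iff] at h
    simp at hp'
  obtain ⟨x₀⟩ := id hX
  obtain ⟨ρ, hρ⟩ := hΩ.exists_section ⟨0, hG⟩
  let K := kernel p T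
  have hK := kernel_nonneg hp hT
  have hK' := sum_kernel hp' hT
  have hε : ∀ᶠ ε : ℝ in 𝓝[>] 0, ∀ t s x y, 0 < perturb K ε t s x y := by
    filter_upwards [Ioo_mem_nhdsGT (zero_lt_one (α := ℝ))] with ε hε
    exact perturb_pos hK hε.1 hε.2
  let Q : ℝ → domainSP Ω → ℝ := fun ε c => gridProb (perturb K ε) G ρ x₀ c.1.1 c.1.2
  let U : Ultrafilter ℝ := Ultrafilter.of (𝓝[>] 0)
  have hU : (U : Filter ℝ) ≤ 𝓝[>] 0 := Ultrafilter.of_le _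
  obtain ⟨P, hP, hlim⟩ := exists_mem_le_nhds_of_forall_mem_Icc U Q
    (hU (hε.mono fun ε h c => gridProb_mem_Icc (fun t s x y => (h t s x y).le) _ _))
  -- The ultrafilter is needed only for the remaining pairs; the prescribed values converge along
  -- the whole filter.
  have heq : ∀ c a, Tendsto (fun ε => Q ε c) (𝓝[>] 0) (𝓝 a) → P c = a := fun c a h =>
    tendsto_nhds_unique ((tendsto_pi_nhds.1 hlim) c) (h.mono_left hU)
  have hGs : G.sort.Pairwise (· < ·) := (Finset.sortedLT_sort G).pairwise
  refine ⟨P, hP, fun n hn c l hc => ?_, fun t s hts u hu xu x y ht hs huG => heq _ _ ?_,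
    fun y => heq _ _ ?_⟩
  · refine (isClosed_setOf_coherentAt c l).mem_of_tendsto hlim (hU (hε.mono fun ε h => ?_))
    exact gridProb_coherent h hρ hn (fun i => (c i).1) l hc
  -- The case `t = s` is separate because `gridProb_history` needs `s` strictly after `t`.
  · rcases hts.eq_or_lt with rfl | hlt
    · refine Tendsto.congr' (hε.mono fun ε h => (gridProb_of_indicator_eq ?_ ?_).symm)
        tendsto_const_nhds
      · exact (gridExp_history_pos h hρ ht huG hu xu x).ne'
      · intro ω hω
        have : ω.1 t = x := hω.1
        simp [hT.self_eq_one, Matrix.one_apply, Set.indicator, stateEvent, this]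
    · obtain ⟨L, M, hLM⟩ := List.append_of_mem ((Finset.mem_sort (r := (· ≤ ·))).2 ht)
      rw [hLM, List.pairwise_append, List.pairwise_cons] at hGs
      have hsM : s ∈ M := by
        have : s ∈ L ++ t :: M := hLM ▸ (Finset.mem_sort (r := (· ≤ ·))).2 hs
        rcases List.mem_append.1 this with h | h
        · exact absurd (hGs.2.2 s h t (by simp)) hlt.not_gt
        · exact (List.mem_cons.1 h).resolve_left hlt.ne'
      -- Chapman-Kolmogorov is available for the unperturbed kernel, so the intermediate points are
      -- removed only in the limit.
      have key := pathExp_state hK' (kernel_chapmanKolmogorov hT) M hGs.2.1.2 t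
        (fun r hr => by exact_mod_cast hGs.2.1.1 r hr) x (fun _ => x₀) hsM y
      rw [kernel_coe hts] at key
      rw [← key]
      refine (tendsto_pathExp (tendsto_perturb K) M t x _ _).congr' (hε.mono fun ε h => ?_)
      exact (gridProb_history h (sum_perturb hK' ε) hρ hLM hsM huG hu xu x y).symm
  · have key := pathExp_state hK' (kernel_chapmanKolmogorov hT) G.sort hGs ⊥
      (fun r _ => WithBot.bot_lt_coe r) x₀ (fun _ => x₀) ((Finset.mem_sort (r := (· ≤ ·))).2 hG) y
    rw [kernel_bot_zero hT] at key
    rw [← key]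
    refine (tendsto_pathExp (tendsto_perturb K) _ _ x₀ _ _).congr' (hε.mono fun ε h => ?_)
    exact (gridProb_univ (sum_perturb hK' ε) hρ hG y).symm

theorem exists_isMarkovChain (hΩ : IsRichPathSpace Ω) (hp : ∀ x, 0 ≤ p x)
    (hp' : ∑ x, p x = 1) (hT : IsTransitionMatrixSystem T) :
    ∃ P : domainSP Ω → ℝ, IsMarkovChain P ∧ transitionFamily P = T ∧
      ∀ y, stateProb P 0 y = p y := by
  have hne : ∀ c ∈ domainSP Ω, c.2.Nonempty := by
    rintro ⟨A, C⟩ ⟨u, xu, -, hC⟩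
    obtain rfl : C = jointEvent Ω u xu := hC
    have hX : Nonempty X := by
      by_contra h
      rw [not_nonempty_iff] at h
      simp at hp'
    -- Richness requires a non-empty set of times, hence the added time `0`.
    obtain ⟨ω, hω, h⟩ := hΩ (insert 0 u) (by simp)
      fun r => if h : r.1 ∈ u then xu ⟨r.1, h⟩ else Classical.arbitrary X
    exact ⟨⟨ω, hω⟩, fun r => by simpa using h ⟨r, by simp⟩⟩
  choose Q hQ hcoh hhist hinit using fun G : Finset ℝ≥0 =>
    exists_grid_assessment hΩ hp hp' hT (Finset.mem_insert_self 0 G)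
  let U : Ultrafilter (Finset ℝ≥0) := Ultrafilter.of atTop
  have hU : (U : Filter (Finset ℝ≥0)) ≤ atTop := Ultrafilter.of_le _
  obtain ⟨P, -, hlim⟩ := exists_mem_le_nhds_of_forall_mem_Icc U Q (.of_forall hQ)
  -- A value prescribed on all grids containing `F` is eventually constant and survives the limit.
  have heq : ∀ (c : domainSP Ω) a (F : Finset ℝ≥0), (∀ G, F ⊆ G → Q G c = a) → P c = a :=
    fun c a F h => tendsto_nhds_unique ((tendsto_pi_nhds.1 hlim) c)
      (tendsto_const_nhds.congr' (hU ((eventually_ge_atTop F).mono fun G hG => (h G hG).symm)))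
  have hP : ∀ (t s : ℝ≥0) (hts : t ≤ s) (u : Finset ℝ≥0) (hu : ∀ r ∈ u, r < t) (xu : u → X)
      (x y : X), historyProb P hts hu xu x y = T t s hts x y := by
    intro t s hts u hu xu x y
    refine heq _ _ (insert t (insert s u)) fun G hG => ?_
    have hsub := hG.trans (Finset.subset_insert 0 G)
    exact hhist G t s hts u hu xu x y (hsub (by simp)) (hsub (by simp))
      fun r hr => hsub (by simp [hr])
  have hPT : transitionFamily P = T := by
    funext t s hts
    ext x y
    rw [← hP t s hts ∅ (by simp) (fun _ => x) x y]
    refine (congr_prob P _ rfl ?_).trans rfl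
    simp [jointEvent]
  refine ⟨P, ⟨⟨hne, fun n hn c l => ?_⟩, fun t s hts u hu xu x y => ?_⟩, hPT, fun y => ?_⟩
  -- Finitely many conditioning events involve finitely many times, so every large enough grid
  -- contains them all.
  · choose u xu _ hc using fun i => (c i).2
    refine (isClosed_setOf_coherentAt c l).mem_of_tendsto hlim
      (hU ((eventually_ge_atTop (Finset.univ.biUnion u)).mono fun G hG => ?_))
    refine hcoh G n hn c l fun i => ⟨u i, ?_, xu i, hc i⟩
    exact (Finset.subset_biUnion_of_mem u (Finset.mem_univ i)).trans
      (hG.trans (Finset.subset_insert 0 G))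
  · rw [hP, hPT]
  · exact heq _ _ ∅ fun G _ => hinit G y

end Existence

end CTMC

theorem mainTheorem5 {X : Type*} [Fintype X] [DecidableEq X]
    (Ω : Set (ℝ≥0 → X)) (hΩ : CTMC.IsRichPathSpace Ω)
    (p : X → ℝ) (hp_nonneg : ∀ x, 0 ≤ p x) (hp_sum : ∑ x, p x = 1)
    (T : CTMC.MatrixFamily X) (hT : CTMC.IsTransitionMatrixSystem T) :
    (∃! P : CTMC.domainSP Ω → ℝ,
      CTMC.IsMarkovChain P ∧ CTMC.transitionFamily P = T ∧
        ∀ y, CTMC.stateProb P 0 y = p y) ∧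
    (∀ P : CTMC.domainSP Ω → ℝ,
      CTMC.IsMarkovChain P → CTMC.transitionFamily P = T →
        (∀ y, CTMC.stateProb P 0 y = p y) →
          (CTMC.IsWellBehavedProcess P ↔ CTMC.IsWellBehavedFamily T)) := by
  refine ⟨?_, fun P hP hPT _ => hPT ▸ hP.isWellBehavedProcess_iff⟩
  obtain ⟨P, hP, hPT, hPp⟩ := CTMC.exists_isMarkovChain hΩ hp_nonneg hp_sum hT
  exact ⟨P, ⟨hP, hPT, hPp⟩, fun Q hQ => hQ.1.eq_of_transitionFamily_eq hP
    (hQ.2.1.trans hPT.symm) fun y => (hQ.2.2 y).trans (hPp y).symm⟩
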